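/- Throughout, C$^*$-algebras are complex and unital, and embeddings are injective unital $*$-homomorphisms. Terms in the language of unital C$^*$-algebras are built from variables and the constants $0$, $1$ by addition, multiplication, the involution $*$, and multiplication by complex scalars. Quantifier-free formulas are built from the atomic formulas $d(s,t)=\|s-t\|$ ($s,t$ terms) by applying arbitrary continuous connectives $f:\mathbb{R}^k\to\mathbb{R}$, $k\ge 0$. For a C$^*$-algebra $A$ and $n\ge 1$ let $A_{\le n}=\{a\in A:\|a\|\le n\}$. An embedding $i:A\to B$ is \emph{existential} if for every quantifier-free formula $\varphi(v,w)$, where $v,w$ are finite tuples of variables, every integer $n\ge 1$ and every tuple $a$ from $A$ of the length of $v$, $$\inf\{\varphi(a,b): b \text{ a tuple from } A_{\le n}\}=\inf\{\varphi(i(a),c): c \text{ a tuple from } B_{\le n}\}.$$ A C$^*$-algebra $A$ is \emph{existentially closed} if every embedding of $A$ into a C$^*$-algebra $B$ is existential. \textbf{Proposition.} If $A$ is an existentially closed unital C$^*$-algebra, then $K_0(A)=\{0\}$. Here $K_0(A)$ is the Grothendieck group of the commutative monoid of Murray--von Neumann equivalence classes of projections in the matrix algebras $M_n(A)$ (where $p\in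 M_m(A)$ and $q\in M_n(A)$ are equivalent if $p=x^*x$ and $q=xx^*$ for some $n\times m$ matrix $x$ over $A$), with addition $[p]+[q]=[p\oplus q]$. -/

import Mathlib

universe u v

/-! ### Quantifier-free formulas in the language of unital C⋆-algebras -/

namespace CStarLogic

/-- Terms in the language of unital C⋆-algebras with variables from `α`: constants `0` and `1`,
addition, multiplication, the involution, and multiplication by each complex scalar. -/
inductive StarTerm (α : Type) : Type where
  | var (x : α) : StarTerm α
  | zero : StarTerm α
  | one : StarTerm α
  | add (s t : StarTerm α) : StarTerm α
  | mul (s t : StarTerm α) : StarTerm α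
  | star (t : StarTerm α) : StarTerm α
  | smul (c : ℂ) (t : StarTerm α) : StarTerm α

/-- The interpretation of a term in a unital C⋆-algebra under an assignment of its variables. -/
def StarTerm.eval {α : Type} {A : Type u} [CStarAlgebra A] (a : α → A) : StarTerm α → A
  | .var x => a x
  | .zero => 0
  | .one => 1
  | .add s t => s.eval a + t.eval a
  | .mul s t => s.eval a * t.eval a
  | .star t => Star.star (t.eval a)
  | .smul c t => c • t.eval a

/-- Quantifier-free formulas of continuous logic: the atomic formulas are the distances `d(s, t)`
of two terms, and any continuous function `ℝᵏ → ℝ` is a `k`-ary connective. -/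
inductive QFFormula (α : Type) : Type where
  | dist (s t : StarTerm α) : QFFormula α
  | conn {k : ℕ} (f : C(Fin k → ℝ, ℝ)) (φ : Fin k → QFFormula α) : QFFormula α

/-- The real value of a quantifier-free formula under an assignment of its variables. -/
def QFFormula.eval {α : Type} {A : Type u} [CStarAlgebra A] (a : α → A) : QFFormula α → ℝ
  | .dist s t => Dist.dist (s.eval a) (t.eval a)
  | .conn f φ => f fun i => (φ i).eval a

lemma StarTerm.exists_norm_eval_le {α : Type} {A : Type u} [CStarAlgebra A] (r : α → ℝ)
    (t : StarTerm α) : ∃ M : ℝ, ∀ a : α → A, (∀ x, ‖a x‖ ≤ r x) → ‖t.eval a‖ ≤ M := by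
  induction t with
  | var x => exact ⟨r x, fun a h => h x⟩
  | zero => exact ⟨0, fun a _ => by simp [StarTerm.eval]⟩
  | one => exact ⟨‖(1 : A)‖, fun a _ => le_rfl⟩
  | add s t hs ht =>
    obtain ⟨M, hM⟩ := hs
    obtain ⟨N, hN⟩ := ht
    exact ⟨M + N, fun a h => (norm_add_le _ _).trans (add_le_add (hM a h) (hN a h))⟩
  | mul s t hs ht =>
    obtain ⟨M, hM⟩ := hs
    obtain ⟨N, hN⟩ := ht
    exact ⟨M * N, fun a h => (norm_mul_le _ _).trans (mul_le_mul (hM a h) (hN a h)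
      (norm_nonneg _) ((norm_nonneg _).trans (hM a h)))⟩
  | star t ht =>
    obtain ⟨M, hM⟩ := ht
    exact ⟨M, fun a h => by simpa [StarTerm.eval] using hM a h⟩
  | smul c t ht =>
    obtain ⟨M, hM⟩ := ht
    exact ⟨‖c‖ * M, fun a h => (norm_smul_le _ _).trans
      (mul_le_mul_of_nonneg_left (hM a h) (norm_nonneg _))⟩

/-- On bounded tuples a quantifier-free formula takes bounded values, so that the real infima
below are genuine. -/
lemma QFFormula.exists_abs_eval_le {α : Type} {A : Type u} [CStarAlgebra A] (r : α → ℝ)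
    (φ : QFFormula α) : ∃ M : ℝ, ∀ a : α → A, (∀ x, ‖a x‖ ≤ r x) → |φ.eval a| ≤ M := by
  induction φ with
  | dist s t =>
    obtain ⟨M, hM⟩ := s.exists_norm_eval_le (A := A) r
    obtain ⟨N, hN⟩ := t.exists_norm_eval_le (A := A) r
    refine ⟨M + N, fun a h => ?_⟩
    rw [QFFormula.eval, abs_of_nonneg dist_nonneg]
    exact (dist_le_norm_add_norm _ _).trans (add_le_add (hM a h) (hN a h))
  | conn f φ ih =>
    choose M hM using ih
    have hc : IsCompact (Set.univ.pi fun i => Set.Icc (-M i) (M i)) :=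
      isCompact_univ_pi fun i => isCompact_Icc
    obtain ⟨N, hN⟩ := hc.exists_bound_of_continuousOn f.continuous.continuousOn
    exact ⟨N, fun a h => hN _ fun i _ => abs_le.mp (hM i a h)⟩

/-- For a quantifier-free formula `φ(v, w)`, a tuple `a` and a radius `n`, the infimum of
`φ(a, b)` over all tuples `b` from the closed ball of radius `n`. -/
noncomputable def infBall {A : Type u} [CStarAlgebra A] {k l : ℕ} (φ : QFFormula (Fin k ⊕ Fin l))
    (a : Fin k → A) (n : ℕ) : ℝ :=
  ⨅ b : {b : Fin l → A // ∀ j, ‖b j‖ ≤ n}, φ.eval (Sum.elim a b.1)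

/-- The set of which `infBall` is the infimum is non-empty and bounded below. -/
lemma isGLB_infBall {A : Type u} [CStarAlgebra A] {k l : ℕ} (φ : QFFormula (Fin k ⊕ Fin l))
    (a : Fin k → A) (n : ℕ) :
    IsGLB {x : ℝ | ∃ b : Fin l → A, (∀ j, ‖b j‖ ≤ n) ∧ φ.eval (Sum.elim a b) = x}
      (infBall φ a n) := by
  obtain ⟨M, hM⟩ := φ.exists_abs_eval_le (A := A) (Sum.elim (fun i => ‖a i‖) fun _ => (n : ℝ))
  have : Nonempty {b : Fin l → A // ∀ j, ‖b j‖ ≤ n} := ⟨⟨0, fun j => by simp⟩⟩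
  have hs : {x : ℝ | ∃ b : Fin l → A, (∀ j, ‖b j‖ ≤ n) ∧ φ.eval (Sum.elim a b) = x} =
      Set.range fun b : {b : Fin l → A // ∀ j, ‖b j‖ ≤ n} => φ.eval (Sum.elim a b.1) := by
    ext x
    simp
  rw [hs]
  refine isGLB_ciInf ⟨-M, ?_⟩
  rintro _ ⟨b, rfl⟩
  refine (abs_le.mp (hM _ ?_)).1
  rintro (i | j)
  · exact le_rfl
  · exact b.2 j

/-- A unital ⋆-homomorphism is existential if it preserves the infima, over each ball, of all
quantifier-free formulas with parameters from the source. -/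
def IsExistentialEmbedding {A : Type u} {B : Type v} [CStarAlgebra A] [CStarAlgebra B]
    (i : A →⋆ₐ[ℂ] B) : Prop :=
  Function.Injective i ∧
    ∀ (k l : ℕ) (φ : QFFormula (Fin k ⊕ Fin l)) (n : ℕ), 1 ≤ n → ∀ a : Fin k → A,
      infBall φ a n = infBall φ (fun j => i (a j)) n

/-- A unital C⋆-algebra is existentially closed if every unital embedding of it into a unital
C⋆-algebra is existential. -/
def IsExistentiallyClosed (A : Type u) [CStarAlgebra A] : Prop :=
  ∀ (B : Type u) [CStarAlgebra B] (i : A →⋆ₐ[ℂ] B),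
    Function.Injective i → IsExistentialEmbedding i

end CStarLogic

/-! ### The group `K₀` of a unital C⋆-algebra -/

namespace CStarK

open Matrix

/-- Murray–von Neumann equivalence of square matrices of possibly different sizes: a rectangular
matrix `x` with `p = x⋆x` and `q = xx⋆`. -/
def MvN {A : Type u} [CStarAlgebra A] {m n : Type*} [Fintype m] [Fintype n]
    (p : Matrix m m A) (q : Matrix n n A) : Prop :=
  ∃ x : Matrix n m A, p = xᴴ * x ∧ q = x * xᴴ

section lemmas

variable {A : Type u} [CStarAlgebra A] {m n l o : Type*} [Fintype m] [Fintype n] [Fintype l]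
  [Fintype o]

lemma MvN.refl {p : Matrix m m A} (hp : IsStarProjection p) : MvN p p := by
  have h1 : p * p = p := hp.isIdempotentElem
  have h2 : pᴴ = p := hp.isSelfAdjoint
  exact ⟨p, by rw [h2, h1], by rw [h2, h1]⟩

lemma MvN.symm {p : Matrix m m A} {q : Matrix n n A} (h : MvN p q) : MvN q p := by
  obtain ⟨x, h1, h2⟩ := h
  exact ⟨xᴴ, by simpa using h2, by simpa using h1⟩

lemma MvN.trans {p : Matrix m m A} {q : Matrix n n A} {r : Matrix l l A}
    (hp : IsStarProjection p) (hr : IsStarProjection r) (h : MvN p q) (h' : MvN q r) :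
    MvN p r := by
  obtain ⟨x, h1, h2⟩ := h
  obtain ⟨y, h3, h4⟩ := h'
  have hp1 : p * p = p := hp.isIdempotentElem
  have hr1 : r * r = r := hr.isIdempotentElem
  refine ⟨y * x, ?_, ?_⟩
  · calc p = p * p := hp1.symm
      _ = xᴴ * (x * xᴴ) * x := by rw [h1]; simp only [Matrix.mul_assoc]
      _ = (y * x)ᴴ * (y * x) := by
        rw [← h2, h3, conjTranspose_mul]; simp only [Matrix.mul_assoc]
  · calc r = r * r := hr1.symm
      _ = y * (yᴴ * y) * yᴴ := by rw [h4]; simp only [Matrix.mul_assoc]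
      _ = (y * x) * (y * x)ᴴ := by
        rw [← h3, h2, conjTranspose_mul]; simp only [Matrix.mul_assoc]

lemma MvN.submatrix {p : Matrix m m A} (hp : IsStarProjection p) (e : n ≃ m) :
    MvN p (p.submatrix e e) := by
  have h1 : p * p = p := hp.isIdempotentElem
  have h2 : pᴴ = p := hp.isSelfAdjoint
  refine ⟨p.submatrix e id, ?_, ?_⟩
  · rw [conjTranspose_submatrix, h2, submatrix_mul_equiv, h1, submatrix_id_id]
  · rw [conjTranspose_submatrix, h2, submatrix_mul p p e id e Function.bijective_id |>.symm, h1]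

lemma MvN.fromBlocks {p : Matrix m m A} {q : Matrix n n A} {p' : Matrix l l A}
    {q' : Matrix o o A} (h : MvN p q) (h' : MvN p' q') :
    MvN (fromBlocks p 0 0 p') (fromBlocks q 0 0 q') := by
  obtain ⟨x, rfl, rfl⟩ := h
  obtain ⟨y, rfl, rfl⟩ := h'
  exact ⟨Matrix.fromBlocks x 0 0 y, by simp [fromBlocks_conjTranspose, fromBlocks_multiply],
    by simp [fromBlocks_conjTranspose, fromBlocks_multiply]⟩

lemma isStarProjection_fromBlocks {p : Matrix m m A} {q : Matrix n n A}
    (hp : IsStarProjection p) (hq : IsStarProjection q) :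
    IsStarProjection (Matrix.fromBlocks p 0 0 q) := by
  have h1 : p * p = p := hp.isIdempotentElem
  have h2 : pᴴ = p := hp.isSelfAdjoint
  have h3 : q * q = q := hq.isIdempotentElem
  have h4 : qᴴ = q := hq.isSelfAdjoint
  refine ⟨?_, ?_⟩
  · simp [IsIdempotentElem, fromBlocks_multiply, h1, h3]
  · simp [IsSelfAdjoint, star_eq_conjTranspose, fromBlocks_conjTranspose, h2, h4]

lemma isStarProjection_submatrix {p : Matrix m m A} (hp : IsStarProjection p) (e : n ≃ m) :
    IsStarProjection (p.submatrix e e) := by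
  have h1 : p * p = p := hp.isIdempotentElem
  have h2 : pᴴ = p := hp.isSelfAdjoint
  refine ⟨?_, ?_⟩
  · rw [IsIdempotentElem, submatrix_mul_equiv, h1]
  · rw [IsSelfAdjoint, star_eq_conjTranspose, conjTranspose_submatrix, h2]

end lemmas

/-- Projections in matrix algebras `M_n(A)` of all sizes `n`. -/
structure MatProj (A : Type u) [CStarAlgebra A] : Type u where
  size : ℕ
  mat : Matrix (Fin size) (Fin size) A
  isProj : IsStarProjection mat

/-- The block-diagonal sum `p ⊕ q`. -/
def MatProj.sum {A : Type u} [CStarAlgebra A] (p q : MatProj A) : MatProj A where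
  size := p.size + q.size
  mat := (fromBlocks p.mat 0 0 q.mat).submatrix finSumFinEquiv.symm finSumFinEquiv.symm
  isProj := isStarProjection_submatrix (isStarProjection_fromBlocks p.isProj q.isProj) _

lemma MatProj.mvN_sum {A : Type u} [CStarAlgebra A] (p q : MatProj A) :
    MvN (fromBlocks p.mat 0 0 q.mat) (p.sum q).mat :=
  MvN.submatrix (isStarProjection_fromBlocks p.isProj q.isProj) _

/-- Murray–von Neumann equivalence on the projections in matrix algebras over `A`. -/
instance MatProj.setoid (A : Type u) [CStarAlgebra A] : Setoid (MatProj A) where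
  r p q := MvN p.mat q.mat
  iseqv := ⟨fun p => MvN.refl p.isProj, fun h => h.symm,
    fun {p _ r} h h' => MvN.trans p.isProj r.isProj h h'⟩

/-- The Murray–von Neumann semigroup of `A`: equivalence classes of projections in matrix
algebras over `A`. -/
def V (A : Type u) [CStarAlgebra A] : Type u := Quotient (MatProj.setoid A)

/-- The class of a projection in the Murray–von Neumann semigroup. -/
def V.mk {A : Type u} [CStarAlgebra A] (p : MatProj A) : V A := Quotient.mk (MatProj.setoid A) p

lemma V.mk_eq {A : Type u} [CStarAlgebra A] {p q : MatProj A} (h : MvN p.mat q.mat) :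
    V.mk p = V.mk q := Quotient.sound h

lemma MatProj.mvN_sum_sum {A : Type u} [CStarAlgebra A] {p q p' q' : MatProj A}
    (h : MvN p.mat p'.mat) (h' : MvN q.mat q'.mat) : MvN (p.sum q).mat (p'.sum q').mat :=
  have h1 := isStarProjection_fromBlocks p'.isProj q'.isProj
  (p.mvN_sum q).symm.trans (p.sum q).isProj (p'.sum q').isProj <|
    (h.fromBlocks h').trans (isStarProjection_fromBlocks p.isProj q.isProj) (p'.sum q').isProj
      (MvN.submatrix h1 _)

/-- Addition `[p] + [q] = [p ⊕ q]`. -/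
instance V.instAdd (A : Type u) [CStarAlgebra A] : Add (V A) where
  add := Quotient.map₂ MatProj.sum fun _ _ h _ _ h' => MatProj.mvN_sum_sum h h'

/-- The neutral element is the class of the `0 × 0` matrix, which is also the class of the zero
projection of any size. -/
instance V.instZero (A : Type u) [CStarAlgebra A] : Zero (V A) where
  zero := V.mk ⟨0, 0, IsStarProjection.zero _⟩

lemma V.mk_add_mk {A : Type u} [CStarAlgebra A] (p q : MatProj A) :
    V.mk p + V.mk q = V.mk (p.sum q) := rfl

/-- The Murray–von Neumann semigroup is a commutative monoid. -/
instance V.addCommMonoid (A : Type u) [CStarAlgebra A] : AddCommMonoid (V A) where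
  add_assoc := by
    rintro ⟨p⟩ ⟨q⟩ ⟨r⟩
    refine V.mk_eq ?_
    have hp := p.isProj
    have hq := q.isProj
    have hr := r.isProj
    have h1 := isStarProjection_fromBlocks (isStarProjection_fromBlocks hp hq) hr
    have h2 := isStarProjection_fromBlocks hp (isStarProjection_fromBlocks hq hr)
    have e1 : MvN ((p.sum q).sum r).mat
        (fromBlocks (fromBlocks p.mat 0 0 q.mat) 0 0 r.mat) :=
      ((p.sum q).mvN_sum r).symm.trans (MatProj.isProj _) h1
        ((p.mvN_sum q).symm.fromBlocks (MvN.refl hr))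
    have e3 : MvN (fromBlocks p.mat 0 0 (fromBlocks q.mat 0 0 r.mat)) (p.sum (q.sum r)).mat :=
      ((MvN.refl hp).fromBlocks (q.mvN_sum r)).trans h2 (MatProj.isProj _)
        (p.mvN_sum (q.sum r))
    have e2 : MvN (fromBlocks (fromBlocks p.mat 0 0 q.mat) 0 0 r.mat)
        (fromBlocks p.mat 0 0 (fromBlocks q.mat 0 0 r.mat)) := by
      have := MvN.submatrix h1 (Equiv.sumAssoc _ _ _).symm
      convert this using 1
      ext (i | i | i) (j | j | j) <;> simp
    exact e1.trans (MatProj.isProj _) (MatProj.isProj _) (e2.trans h1 (MatProj.isProj _) e3)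
  zero_add := by
    rintro ⟨p⟩
    refine V.mk_eq ?_
    have h0 : IsStarProjection (0 : Matrix (Fin 0) (Fin 0) A) := IsStarProjection.zero _
    refine ((MatProj.mvN_sum ⟨0, 0, h0⟩ p).symm).trans (MatProj.isProj _) p.isProj ?_
    have := MvN.submatrix (isStarProjection_fromBlocks h0 p.isProj)
      (Equiv.emptySum (Fin 0) (Fin p.size)).symm
    convert this using 1
    ext i j
    simp
  add_zero := by
    rintro ⟨p⟩
    refine V.mk_eq ?_
    have h0 : IsStarProjection (0 : Matrix (Fin 0) (Fin 0) A) := IsStarProjection.zero _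
    refine ((MatProj.mvN_sum p ⟨0, 0, h0⟩).symm).trans (MatProj.isProj _) p.isProj ?_
    have := MvN.submatrix (isStarProjection_fromBlocks p.isProj h0)
      (Equiv.sumEmpty (Fin p.size) (Fin 0)).symm
    convert this using 1
    ext i j
    simp
  nsmul := nsmulRec
  add_comm := by
    rintro ⟨p⟩ ⟨q⟩
    refine V.mk_eq ?_
    have h1 := isStarProjection_fromBlocks p.isProj q.isProj
    refine (p.mvN_sum q).symm.trans (MatProj.isProj _) (MatProj.isProj _) ?_
    refine MvN.trans h1 (MatProj.isProj _) ?_ (q.mvN_sum p)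
    have := MvN.submatrix h1 (Equiv.sumComm (Fin q.size) (Fin p.size))
    convert this using 1
    ext (i | i) (j | j) <;> simp

/-- `K₀` of a unital C⋆-algebra: the Grothendieck group of its Murray–von Neumann semigroup. -/
abbrev K0 (A : Type u) [CStarAlgebra A] : Type u := Algebra.GrothendieckAddGroup (V A)

end CStarK

/-! Every projection `p` over an existentially closed `A` satisfies `p ∼ p ⊕ p`. Hence every element
of `V A` is idempotent, and an idempotent element of a monoid becomes zero in any group. The
equivalence is first produced in an extension. Represent `A` faithfully on `H` and let it act
coordinatewise on `ℓ²(ℕ, H)`. Restricting sequences to two complementary halves of `ℕ` gives Cuntz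
coisometries commuting with `A` (`exists_embedding_commute_cuntz`), and the column with entries `c j
* p` then implements `p ∼ p ⊕ p` (`mvN_fromBlocks_self_of_commute`). It descends to `A` by
`IsExistentiallyClosed.mvN_of_mvN_map`: equivalence of two given projections is a zero of a
quantifier-free formula, so `A` contains approximate solutions, and a polar decomposition turns a
good enough one into an exact one (`exists_star_mul_self_eq_of_norm_lt`). -/

/-! ### Approximate Murray–von Neumann equivalence implies equivalence. -/

section Perturbation

variable {C : Type*} [CStarAlgebra C]

/-- If `z = q z p` for projections `p`, `q`, and `z⋆z`, `zz⋆` are invertible in the corners of `p`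
and `q`, then the polar decomposition of `z` implements an equivalence between `p` and `q`. -/
lemma exists_star_mul_self_eq_of_isUnit {p q z : C} (hp : IsStarProjection p)
    (hq : IsStarProjection q) (hzp : z * p = z) (hqz : q * z = z)
    (h1 : IsUnit (star z * z + 1 - p)) (h2 : IsUnit (z * star z + 1 - q)) :
    ∃ x : C, star x * x = p ∧ x * star x = q := by
  let _ := CStarAlgebra.spectralOrder C
  have := CStarAlgebra.spectralOrderedRing C
  have hpp : p * p = p := hp.isIdempotentElem
  have hps : star p = p := hp.isSelfAdjoint
  have hqq : q * q = q := hq.isIdempotentElem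
  have hqs : star q = q := hq.isSelfAdjoint
  have hpz : p * star z = star z := by
    have := congrArg star hzp
    rwa [star_mul, hps] at this
  have hzq : star z * q = star z := by
    have := congrArg star hqz
    rwa [star_mul, hqs] at this
  set w := star z * z + 1 - p with hw
  have hwp : w * p = star z * z := by
    rw [hw, sub_mul, add_mul, mul_assoc, hzp, hpp, one_mul, add_sub_cancel_right]
  have hpw : p * w = star z * z := by
    rw [hw, mul_sub, mul_add, ← mul_assoc, hpz, hpp, mul_one, add_sub_cancel_right]
  -- `w` is a sum of two positive elements, since `1 - p` is again a projection. It has a square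
  -- root `v`, and `z * v⁻¹` is the polar part of `z`.
  have hw0 : 0 ≤ w := by
    have h3 : star (1 - p) * (1 - p) = 1 - p := by
      rw [star_sub, star_one, hps, sub_mul, one_mul, mul_sub, mul_one, hpp, sub_self, sub_zero]
    rw [hw, add_sub_assoc, ← h3]
    exact add_nonneg (star_mul_self_nonneg z) (star_mul_self_nonneg _)
  set v := CFC.sqrt w with hv
  have hvv : v * v = w := CFC.sqrt_mul_sqrt_self w
  have hvs : star v = v := (CFC.sqrt_nonneg w).isSelfAdjoint
  have hvp : Commute v p := Commute.cfcₙ_nnreal (show Commute w p from hwp.trans hpw.symm) _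
  have hvu : IsUnit v := by
    rw [← hvv] at h1
    exact ((Commute.refl v).isUnit_mul_iff.mp h1).1
  obtain ⟨u, hu⟩ := hvu
  set t : C := ↑u⁻¹ with ht
  have hvt : v * t = 1 := by rw [← hu, ht, Units.mul_inv]
  have htv : t * v = 1 := by rw [← hu, ht, Units.inv_mul]
  have hts : star t = t := by
    have h3 : star t * v = 1 := by rw [← hvs, ← star_mul, hvt, star_one]
    calc star t = star t * (v * t) := by rw [hvt, mul_one]
      _ = t := by rw [← mul_assoc, h3, one_mul]
  have htp : t * p = p * t := by
    calc t * p = t * p * (v * t) := by rw [hvt, mul_one]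
      _ = t * (p * v) * t := by simp only [mul_assoc]
      _ = t * (v * p) * t := by rw [hvp.eq]
      _ = p * t := by rw [← mul_assoc, htv, one_mul]
  have hxx : star (z * t) * (z * t) = p := by
    calc star (z * t) * (z * t) = t * (star z * z) * t := by
          rw [star_mul, hts]; simp only [mul_assoc]
      _ = t * (v * v * p) * t := by rw [← hwp, hvv]
      _ = (t * v) * v * (p * t) := by simp only [mul_assoc]
      _ = p := by rw [htv, one_mul, ← htp, ← mul_assoc, hvt, one_mul]
  refine ⟨z * t, hxx, ?_⟩
  -- The range projection of `z * t` fixes `z * star z`. Invertibility of `z * star z` in the corner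
  -- of `q` then forces it to be all of `q`.
  have hr : (z * t) * star (z * t) * (z * star z) = z * star z := by
    calc (z * t) * star (z * t) * (z * star z)
        = z * t * (t * (star z * z) * star z) := by
          rw [star_mul, hts]; simp only [mul_assoc]
      _ = z * (t * (t * v) * v * (p * star z)) := by
          rw [← hwp, ← hvv]; simp only [mul_assoc]
      _ = z * star z := by rw [htv, mul_one, htv, hpz, one_mul]
  have hrq : (z * t) * star (z * t) * q = (z * t) * star (z * t) := by
    rw [star_mul]; simp only [mul_assoc, hzq]
  have h0 : ((z * t) * star (z * t) - q) * (z * star z + 1 - q) = 0 := by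
    have hqzz : q * (z * star z) = z * star z := by rw [← mul_assoc, hqz]
    rw [mul_sub, mul_add, sub_mul, sub_mul _ _ q, hr, hrq, hqq, mul_one, hqzz]
    abel
  exact sub_eq_zero.mp (h2.mul_left_eq_zero.mp h0)

/-- For `z = q * y * p` the left-hand term is `star z * z`, so the bound makes it invertible in the
corner of `p`. The errors add up to `9/64 + 8/64 + 9/64 < 1`. -/
lemma norm_star_mul_self_sub_lt {p q y : C} (hp : IsStarProjection p)
    (h1 : ‖star y * y - p‖ < 1 / 8) (h2 : ‖y * star y - q‖ < 1 / 8) :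
    ‖p * (star y * q * y) * p - p‖ < 1 := by
  have hpp : p * p = p := hp.isIdempotentElem
  have hpn : ‖p‖ ≤ 1 := hp.norm_le
  have hyy : ‖y‖ * ‖y‖ ≤ 9 / 8 := by
    rw [← CStarRing.norm_star_mul_self]
    calc ‖star y * y‖ = ‖(star y * y - p) + p‖ := by rw [sub_add_cancel]
      _ ≤ 1 / 8 + 1 := (norm_add_le _ _).trans (add_le_add h1.le hpn)
      _ = 9 / 8 := by norm_num
  have e : p * (star y * q * y) * p - p =
      p * (star y * y * (star y * y - p) + (star y * y - p) * p
        - star y * (y * star y - q) * y) * p := by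
    have e1 : star y * y * (star y * y - p) + (star y * y - p) * p
        - star y * (y * star y - q) * y = star y * q * y - p := by
      simp only [mul_sub, sub_mul, mul_assoc, hpp]; abel
    rw [e1, mul_sub, sub_mul, hpp, hpp]
  have n1 : ‖star y * y * (star y * y - p)‖ ≤ 9 / 8 * (1 / 8) := by
    refine (norm_mul_le _ _).trans (mul_le_mul ?_ h1.le (norm_nonneg _) (by norm_num))
    rwa [CStarRing.norm_star_mul_self]
  have n2 : ‖(star y * y - p) * p‖ ≤ 1 / 8 * 1 :=
    (norm_mul_le _ _).trans (mul_le_mul h1.le hpn (norm_nonneg _) (by norm_num))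
  have n3 : ‖star y * (y * star y - q) * y‖ ≤ 9 / 8 * (1 / 8) := by
    calc ‖star y * (y * star y - q) * y‖ ≤ ‖star y‖ * ‖y * star y - q‖ * ‖y‖ :=
          (norm_mul_le _ _).trans (mul_le_mul_of_nonneg_right (norm_mul_le _ _) (norm_nonneg _))
      _ = ‖y‖ * ‖y‖ * ‖y * star y - q‖ := by rw [norm_star]; ring
      _ ≤ 9 / 8 * (1 / 8) := mul_le_mul hyy h2.le (norm_nonneg _) (by norm_num)
  have n4 := (norm_sub_le (star y * y * (star y * y - p) + (star y * y - p) * p)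
    (star y * (y * star y - q) * y)).trans (add_le_add ((norm_add_le _ _).trans
      (add_le_add n1 n2)) n3)
  rw [e]
  calc _ ≤ ‖p‖ * _ * ‖p‖ :=
        (norm_mul_le _ _).trans (mul_le_mul_of_nonneg_right (norm_mul_le _ _) (norm_nonneg _))
    _ ≤ 1 * (9 / 8 * (1 / 8) + 1 / 8 * 1 + 9 / 8 * (1 / 8)) * 1 := by gcongr
    _ < 1 := by norm_num

/-- Projections that are approximately Murray–von Neumann equivalent are equivalent. -/
lemma exists_star_mul_self_eq_of_norm_lt {p q y : C} (hp : IsStarProjection p)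
    (hq : IsStarProjection q) (h1 : ‖star y * y - p‖ < 1 / 8) (h2 : ‖y * star y - q‖ < 1 / 8) :
    ∃ x : C, star x * x = p ∧ x * star x = q := by
  have hpp : p * p = p := hp.isIdempotentElem
  have hps : star p = p := hp.isSelfAdjoint
  have hqq : q * q = q := hq.isIdempotentElem
  have hqs : star q = q := hq.isSelfAdjoint
  have unit_of {a b : C} (h : ‖a - b‖ < 1) : IsUnit (a + 1 - b) := by
    rw [show a + 1 - b = 1 - (b - a) by abel]
    exact isUnit_one_sub_of_norm_lt_one (by rwa [norm_sub_rev])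
  have n1 := norm_star_mul_self_sub_lt hp h1 h2
  have n2 := norm_star_mul_self_sub_lt (y := star y) hq (by rwa [star_star])
    (by rwa [star_star])
  -- Cutting `y` down by both projections makes the support conditions exact.
  refine exists_star_mul_self_eq_of_isUnit (z := q * y * p) hp hq
    (by rw [mul_assoc, hpp]) (by rw [← mul_assoc, ← mul_assoc, hqq]) (unit_of ?_) (unit_of ?_)
  · convert n1 using 3
    simp only [star_mul, hps, hqs]
    calc p * (star y * q) * (q * y * p) = p * (star y * (q * q) * y) * p := by
          simp only [mul_assoc]
      _ = _ := by rw [hqq]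
  · convert n2 using 3
    simp only [star_mul, hps, hqs, star_star]
    calc q * y * p * (p * (star y * q)) = q * (y * (p * p) * star y) * q := by
          simp only [mul_assoc]
      _ = _ := by rw [hpp]

end Perturbation

open Matrix in
/-- For projections in `Mₙ(A)`, an entrywise approximate equivalence yields an equivalence. -/
lemma CStarK.exists_mvN_of_norm_lt {A : Type*} [CStarAlgebra A] {n : Type*} [Fintype n]
    {p q : Matrix n n A} (hp : IsStarProjection p) (hq : IsStarProjection q) :
    ∃ ε > 0, ∀ y : Matrix n n A, (∀ i j, ‖(yᴴ * y - p) i j‖ < ε) →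
      (∀ i j, ‖(y * yᴴ - q) i j‖ < ε) → MvN p q := by
  classical
  let _ := CStarAlgebra.spectralOrder A
  have := CStarAlgebra.spectralOrderedRing A
  let L : Matrix n n A →L[ℂ] CStarMatrix n n A :=
    (CStarMatrix.ofMatrixL (A := A) : Matrix n n A ≃L[ℂ] CStarMatrix n n A)
  -- Continuity at `0` suffices to pass from entrywise bounds to the C⋆-norm, so `ε` needs no
  -- explicit dependence on the matrix size.
  have hL : ∀ᶠ M : n → n → A in nhds 0, ‖L (Matrix.of M)‖ < 1 / 8 := by
    have hc : Continuous fun M : n → n → A => ‖L (Matrix.of M)‖ := (L.continuous).norm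
    refine hc.continuousAt.eventually_lt_const ?_
    have : L (Matrix.of (0 : n → n → A)) = 0 := map_zero L
    change ‖L (Matrix.of (0 : n → n → A))‖ < 1 / 8
    rw [this, norm_zero]
    norm_num
  obtain ⟨ε, hε, h⟩ := Metric.eventually_nhds_iff.mp hL
  refine ⟨ε, hε, fun y h1 h2 => ?_⟩
  have key (M : Matrix n n A) (hM : ∀ i j, ‖M i j‖ < ε) :
      ‖(CStarMatrix.ofMatrix M : CStarMatrix n n A)‖ < 1 / 8 := by
    refine h (y := fun i j => M i j) ?_
    rw [dist_zero_right]
    exact (pi_norm_lt_iff hε).mpr fun i => (pi_norm_lt_iff hε).mpr fun j => hM i j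
  have cast (M : Matrix n n A) (hM : IsStarProjection M) :
      IsStarProjection (CStarMatrix.ofMatrix M : CStarMatrix n n A) :=
    ⟨hM.isIdempotentElem, hM.isSelfAdjoint⟩
  obtain ⟨x, hx1, hx2⟩ := exists_star_mul_self_eq_of_norm_lt
    (y := (CStarMatrix.ofMatrix y : CStarMatrix n n A)) (cast p hp) (cast q hq) (key _ h1) (key _ h2)
  exact ⟨CStarMatrix.ofMatrix.symm x, hx1.symm, hx2.symm⟩

/-! ### Positive functionals and GNS representations. -/

section PositiveFunctionals

open scoped ComplexOrder ComplexStarModule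

variable {A : Type*} [CStarAlgebra A] [PartialOrder A] [StarOrderedRing A]

/-- The complexification of a real functional on the self-adjoint part. -/
noncomputable def complexifyFunctional (g : A →ₗ[ℝ] ℝ) : A →ₗ[ℂ] ℂ where
  toFun x := ⟨g (ℜ x : A), g (ℑ x : A)⟩
  map_add' x y := by
    apply Complex.ext <;> simp
  map_smul' z x := by
    apply Complex.ext <;> simp [realPart_smul, imaginaryPart_smul]

lemma complexifyFunctional_of_nonneg (g : A →ₗ[ℝ] ℝ) {x : A} (hx : 0 ≤ x) :
    complexifyFunctional g x = g x := by
  have h : IsSelfAdjoint x := hx.isSelfAdjoint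
  apply Complex.ext <;> simp [complexifyFunctional, h.coe_realPart, h.imaginaryPart]

/-- Positive functionals separate points. -/
lemma exists_positiveLinearMap_star_mul_self_ne_zero {a : A} (ha : a ≠ 0) :
    ∃ f : A →ₚ[ℂ] ℂ, f (star a * a) ≠ 0 := by
  have hb : ¬ (0 : A) ≤ -(star a * a) := fun h => ha <| by
    have h0 := le_antisymm (neg_nonneg.mp h) (star_mul_self_nonneg a)
    exact CStarRing.star_mul_self_eq_zero_iff a |>.mp h0
  -- Hahn–Banach: the closed positive cone is separated from a point outside it.
  obtain ⟨g, hg, hga⟩ := (ProperCone.positive ℝ A).hyperplane_separation_point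
    (x₀ := -(star a * a)) (by simpa using hb)
  refine ⟨.mk₀ (complexifyFunctional (g : A →ₗ[ℝ] ℝ)) fun x hx => ?_, ?_⟩
  · rw [complexifyFunctional_of_nonneg _ hx]
    exact_mod_cast hg x hx
  · have := complexifyFunctional_of_nonneg (g : A →ₗ[ℝ] ℝ) (star_mul_self_nonneg a)
    change complexifyFunctional (g : A →ₗ[ℝ] ℝ) (star a * a) ≠ 0
    rw [this]
    simp only [map_neg, Left.neg_neg_iff] at hga
    exact_mod_cast hga.ne'

/-- The image of `a` sends the vector of `1` to a vector of squared norm `f (star a * a)`. -/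
lemma PositiveLinearMap.gnsStarAlgHom_ne_zero (f : A →ₚ[ℂ] ℂ) {a : A}
    (ha : f (star a * a) ≠ 0) : f.gnsStarAlgHom a ≠ 0 := by
  intro h
  have h1 : f.gnsNonUnitalStarAlgHom a (f.toPreGNS 1 : f.GNS) = 0 :=
    congrArg (fun T : f.GNS →L[ℂ] f.GNS => T (f.toPreGNS 1 : f.GNS)) h
  rw [PositiveLinearMap.gnsNonUnitalStarAlgHom_apply_coe] at h1
  have h2 : ‖f.leftMulMapPreGNS a (f.toPreGNS 1)‖ = 0 := by
    rw [← UniformSpace.Completion.norm_coe, h1, norm_zero]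
  have h3 := f.preGNS_norm_sq (f.leftMulMapPreGNS a (f.toPreGNS 1))
  rw [h2] at h3
  apply ha
  simpa using h3.symm

end PositiveFunctionals

/-! ### Hilbert sums of representations and Gelfand–Naimark. -/

section DirectSum

open scoped InnerProductSpace

variable {A : Type*} [CStarAlgebra A] {ι : Type*} {H : ι → Type*}
  [∀ i, NormedAddCommGroup (H i)] [∀ i, InnerProductSpace ℂ (H i)] [∀ i, CompleteSpace (H i)]

/-- The Hilbert space direct sum of a family of representations. -/
noncomputable def directSumRep (π : ∀ i, A →⋆ₐ[ℂ] (H i →L[ℂ] H i)) :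
    A →⋆ₐ[ℂ] (lp H 2 →L[ℂ] lp H 2) where
  toFun a := lp.mapCLM 2 (fun i => π i a) (norm_nonneg a)
    fun i => NonUnitalStarAlgHom.norm_apply_le (π i) a
  map_one' := by ext; simp
  map_mul' a b := by ext; simp
  map_zero' := by ext; simp
  map_add' a b := by ext; simp
  commutes' r := by ext; simp [Algebra.algebraMap_eq_smul_one]
  map_star' a := by
    refine (ContinuousLinearMap.eq_adjoint_iff _ _).mpr fun v w => ?_
    simp only [lp.inner_eq_tsum]
    refine tsum_congr fun i => ?_
    simp [map_star, ContinuousLinearMap.star_eq_adjoint, ContinuousLinearMap.adjoint_inner_left]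

@[simp]
lemma directSumRep_apply (π : ∀ i, A →⋆ₐ[ℂ] (H i →L[ℂ] H i)) (a : A) (v : lp H 2) (i : ι) :
    directSumRep π a v i = π i a (v i) := rfl

lemma directSumRep_injective (π : ∀ i, A →⋆ₐ[ℂ] (H i →L[ℂ] H i))
    (h : ∀ a : A, a ≠ 0 → ∃ i, π i a ≠ 0) : Function.Injective (directSumRep π) := by
  classical
  refine (injective_iff_map_eq_zero _).mpr fun a ha => ?_
  by_contra hne
  obtain ⟨i, hi⟩ := h a hne
  refine hi (ContinuousLinearMap.ext fun x => ?_)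
  have : directSumRep π a (lp.single 2 i x) i = 0 := by rw [ha]; rfl
  simpa using this

end DirectSum

/-- **Gelfand–Naimark**: a unital C⋆-algebra has a faithful representation on a Hilbert space. -/
theorem exists_injective_starAlgHom_clm (A : Type u) [CStarAlgebra A] :
    ∃ (H : Type u) (_ : NormedAddCommGroup H) (_ : InnerProductSpace ℂ H) (_ : CompleteSpace H)
      (π : A →⋆ₐ[ℂ] (H →L[ℂ] H)), Function.Injective π := by
  let _ := CStarAlgebra.spectralOrder A
  have := CStarAlgebra.spectralOrderedRing A
  open scoped ComplexOrder in
  -- Summing over all positive functionals keeps the space in the universe of `A`, where existential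
  -- closedness tests its extensions.
  exact ⟨lp (fun f : A →ₚ[ℂ] ℂ => f.GNS) 2, inferInstance, inferInstance, inferInstance,
    directSumRep fun f => f.gnsStarAlgHom, directSumRep_injective _ fun a ha => by
      obtain ⟨f, hf⟩ := exists_positiveLinearMap_star_mul_self_ne_zero ha
      exact ⟨f, f.gnsStarAlgHom_ne_zero hf⟩⟩

/-! ### Cuntz coisometries on square-summable sequences. -/

section Infinite

variable {H : Type*} [NormedAddCommGroup H] [InnerProductSpace ℂ H]

/-- Restriction of square-summable sequences along an injective reindexing. -/
noncomputable def lpReindex {ι κ : Type*} (e : κ → ι) (he : Function.Injective e) :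
    lp (fun _ : ι => H) 2 →L[ℂ] lp (fun _ : κ => H) 2 :=
  LinearMap.mkContinuous
    { toFun v := ⟨fun k => v (e k), memℓp_gen
        (((lp.memℓp v).summable (by norm_num)).comp_injective he)⟩
      map_add' _ _ := rfl
      map_smul' _ _ := rfl }
    1 fun v => by
      rw [one_mul]
      refine lp.norm_le_of_tsum_le (by norm_num) (norm_nonneg v) ?_
      rw [lp.norm_rpow_eq_tsum (by norm_num)]
      exact tsum_comp_le_tsum_of_inj ((lp.memℓp v).summable (by norm_num))
        (fun i => by positivity) he

/-- The restriction of square-summable sequences to one of two complementary halves of the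
index set. -/
noncomputable def lpHalf (H : Type*) [NormedAddCommGroup H] [InnerProductSpace ℂ H] {ι : Type*}
    (e : Bool × ι ≃ ι) (b : Bool) : lp (fun _ : ι => H) 2 →L[ℂ] lp (fun _ : ι => H) 2 :=
  lpReindex (fun k => e (b, k)) fun _ _ h => congrArg Prod.snd (e.injective h)

/-- Interleave the two sequences along `e`. This joint surjectivity is what yields the orthogonality
relations. -/
lemma exists_lpHalf_eq {ι : Type*} (e : Bool × ι ≃ ι) (u : Bool → lp (fun _ : ι => H) 2) :
    ∃ w, ∀ b, lpHalf H e b w = u b := by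
  have hs : Summable fun x : Bool × ι => ‖u x.1 x.2‖ ^ (2 : ENNReal).toReal :=
    (summable_prod_of_nonneg fun x => by positivity).mpr
      ⟨fun b => (lp.memℓp (u b)).summable (by norm_num), Summable.of_finite⟩
  let w : lp (fun _ : ι => H) 2 :=
    ⟨fun i => u (e.symm i).1 (e.symm i).2, memℓp_gen (e.symm.summable_iff.mpr hs)⟩
  refine ⟨w, fun b => lp.ext (funext fun k => ?_)⟩
  change u (e.symm (e (b, k))).1 (e.symm (e (b, k))).2 = u b k
  rw [e.symm_apply_apply]

variable [CompleteSpace H]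

lemma tsum_eq_tsum_add_tsum_bool {ι : Type*} (e : Bool × ι ≃ ι) {F : ι → ℂ} (hF : Summable F) :
    ∑' i, F i = ∑' k, F (e (true, k)) + ∑' k, F (e (false, k)) := by
  have h : Summable fun x => F (e x) := e.summable_iff.mpr hF
  rw [← e.tsum_eq, h.tsum_prod, tsum_bool, add_comm]

lemma ContinuousLinearMap.sum_star_mul_self_eq_one {S T : H →L[ℂ] H}
    (h : ∀ v w, inner ℂ v w = inner ℂ (S v) (S w) + inner ℂ (T v) (T w)) :
    star S * S + star T * T = 1 := by
  refine ContinuousLinearMap.ext fun v => ext_inner_right ℂ fun w => ?_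
  change inner ℂ (ContinuousLinearMap.adjoint S (S v) + ContinuousLinearMap.adjoint T (T v)) w =
    inner ℂ v w
  rw [inner_add_left, ContinuousLinearMap.adjoint_inner_left,
    ContinuousLinearMap.adjoint_inner_left, h v w]

lemma sum_star_lpHalf_mul_self {ι : Type*} (e : Bool × ι ≃ ι) :
    star (lpHalf H e true) * lpHalf H e true + star (lpHalf H e false) * lpHalf H e false = 1 :=
  ContinuousLinearMap.sum_star_mul_self_eq_one fun v w => by
    rw [lp.inner_eq_tsum, lp.inner_eq_tsum, lp.inner_eq_tsum]
    exact tsum_eq_tsum_add_tsum_bool e (lp.summable_inner (𝕜 := ℂ) v w)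

lemma lpHalf_mul_star_lpHalf {ι : Type*} (e : Bool × ι ≃ ι) (i j : Bool) :
    lpHalf H e i * star (lpHalf H e j) = if i = j then 1 else 0 := by
  refine ContinuousLinearMap.ext fun v => ?_
  -- This `w` is `star (lpHalf H e j) v`: apply the relation summing to `1` to `w`, where only the
  -- `j` term survives.
  obtain ⟨w, hw⟩ := exists_lpHalf_eq e fun b => if b = j then v else 0
  have h3 : star (lpHalf H e j) v = w := by
    have : star (lpHalf H e true) (lpHalf H e true w) +
        star (lpHalf H e false) (lpHalf H e false w) = w :=
      congrArg (fun T : lp (fun _ : ι => H) 2 →L[ℂ] lp (fun _ : ι => H) 2 => T w)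
        (sum_star_lpHalf_mul_self e)
    rw [hw, hw] at this
    cases j <;> simpa using this
  change lpHalf H e i (star (lpHalf H e j) v) = _
  rw [h3, hw]
  split_ifs <;> rfl

end Infinite

/-- Every unital C⋆-algebra embeds into one in which its relative commutant contains a copy of
the Cuntz algebra `𝒪₂`. -/
theorem exists_embedding_commute_cuntz (A : Type u) [CStarAlgebra A] :
    ∃ (B : Type u) (_ : CStarAlgebra B) (i : A →⋆ₐ[ℂ] B) (c : Bool → B), Function.Injective i ∧
      star (c true) * c true + star (c false) * c false = 1 ∧
      (∀ j k, c j * star (c k) = if j = k then 1 else 0) ∧ ∀ j a, Commute (c j) (i a) := by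
  obtain ⟨H, _, _, _, π, hπ⟩ := exists_injective_starAlgHom_clm A
  obtain ⟨e⟩ : Nonempty (Bool × ℕ ≃ ℕ) := ⟨Equiv.boolProdNatEquivNat⟩
  refine ⟨lp (fun _ : ℕ => H) 2 →L[ℂ] lp (fun _ : ℕ => H) 2, inferInstance,
    directSumRep fun _ => π, lpHalf H e, directSumRep_injective _ fun a ha => ⟨0, ?_⟩,
    sum_star_lpHalf_mul_self e, lpHalf_mul_star_lpHalf e, fun j a => ?_⟩
  · exact (map_ne_zero_iff π hπ).mpr ha
  -- `π a` is the same operator in every coordinate, so reindexing commutes with it.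
  · exact ContinuousLinearMap.ext fun v => lp.ext rfl

/-! ### Equivalence of projections as a quantifier-free condition. -/

namespace CStarLogic

/-- The sum of a finite family of terms. -/
noncomputable def StarTerm.sum {α : Type} {ι : Type*} [Fintype ι] (t : ι → StarTerm α) :
    StarTerm α :=
  (Finset.univ.toList.map t).foldr .add .zero

lemma StarTerm.eval_sum {α : Type} {ι : Type*} [Fintype ι] {A : Type u} [CStarAlgebra A]
    (a : α → A) (t : ι → StarTerm α) : (StarTerm.sum t).eval a = ∑ i, (t i).eval a := by
  have h (l : List ι) :
      StarTerm.eval a ((l.map t).foldr .add .zero) = (l.map fun i => (t i).eval a).sum := by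
    induction l with
    | nil => rfl
    | cons i l ih => simp [StarTerm.eval, ih]
  rw [StarTerm.sum, h, Finset.sum_map_toList]

/-- The sum of a finite family of formulas. -/
noncomputable def QFFormula.sum {α : Type} {ι : Type*} [Fintype ι] (φ : ι → QFFormula α) :
    QFFormula α :=
  .conn ⟨fun x : Fin (Fintype.card ι) → ℝ => ∑ i, x i, by fun_prop⟩
    fun j => φ ((Fintype.equivFin ι).symm j)

lemma QFFormula.eval_sum {α : Type} {ι : Type*} [Fintype ι] {A : Type u} [CStarAlgebra A]
    (a : α → A) (φ : ι → QFFormula α) : (QFFormula.sum φ).eval a = ∑ i, (φ i).eval a := by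
  simp only [QFFormula.sum, QFFormula.eval, ContinuousMap.coe_mk]
  exact (Fintype.equivFin ι).symm.sum_comp fun i => (φ i).eval a

section MvNFormula

open Matrix

variable (n : Type*) [Fintype n]

/-- The parameters `p`, `q` of `mvNFormula`, as a tuple. -/
noncomputable def mvNParams {A : Type*} (p q : Matrix n n A) :
    Fin (Fintype.card ((n × n) ⊕ (n × n))) → A := fun j =>
  Sum.elim (fun x => p x.1 x.2) (fun x => q x.1 x.2) ((Fintype.equivFin _).symm j)

/-- The entries of a matrix as a tuple. -/
noncomputable def matrixTuple {A : Type*} (y : Matrix n n A) : Fin (Fintype.card (n × n)) → A :=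
  fun j => y ((Fintype.equivFin _).symm j).1 ((Fintype.equivFin _).symm j).2

/-- The formula measuring, entrywise, how far `y⋆y` is from `p` and `yy⋆` from `q`. -/
noncomputable def mvNFormula :
    QFFormula (Fin (Fintype.card ((n × n) ⊕ (n × n))) ⊕ Fin (Fintype.card (n × n))) :=
  let Y : n → n → StarTerm _ := fun a b => .var (.inr (Fintype.equivFin _ (a, b)))
  .sum (Sum.elim
    (fun x : n × n => .dist (.sum fun c => .mul (.star (Y c x.1)) (Y c x.2))
      (.var (.inl (Fintype.equivFin _ (.inl x)))))
    (fun x : n × n => .dist (.sum fun c => .mul (Y x.1 c) (.star (Y x.2 c)))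
      (.var (.inl (Fintype.equivFin _ (.inr x))))))

variable {n}

lemma eval_mvNFormula {A : Type u} [CStarAlgebra A] (p q y : Matrix n n A) :
    (mvNFormula n).eval (Sum.elim (mvNParams n p q) (matrixTuple n y)) =
      ∑ x : n × n, ‖(yᴴ * y - p) x.1 x.2‖ + ∑ x : n × n, ‖(y * yᴴ - q) x.1 x.2‖ := by
  simp [mvNFormula, QFFormula.eval_sum, QFFormula.eval, StarTerm.eval_sum, StarTerm.eval,
    mvNParams, matrixTuple, dist_eq_norm, Matrix.mul_apply]

/-- An existentially closed C⋆-algebra detects Murray–von Neumann equivalence of its projections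
in extensions. -/
theorem IsExistentiallyClosed.mvN_of_mvN_map {A B : Type u} [CStarAlgebra A] [CStarAlgebra B]
    (hA : IsExistentiallyClosed A) {i : A →⋆ₐ[ℂ] B} (hi : Function.Injective i)
    {p q : Matrix n n A} (hp : IsStarProjection p) (hq : IsStarProjection q)
    (h : CStarK.MvN (p.map i) (q.map i)) : CStarK.MvN p q := by
  obtain ⟨ε, hε, key⟩ := CStarK.exists_mvN_of_norm_lt hp hq
  obtain ⟨x, hx1, hx2⟩ := h
  -- The ball must contain the entries of the witness `x`; the `1` is there because only radii `N ≥
  -- 1` are allowed.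
  obtain ⟨N, hN⟩ := exists_nat_ge (max 1 ‖matrixTuple n x‖)
  have hN1 : 1 ≤ N := by exact_mod_cast (le_max_left _ _).trans hN
  have hparams : (fun j => i (mvNParams n p q j)) = mvNParams n (p.map i) (q.map i) := by
    funext j
    simp only [mvNParams]
    rcases (Fintype.equivFin ((n × n) ⊕ (n × n))).symm j with x | x <;> rfl
  have hB : infBall (mvNFormula n) (mvNParams n (p.map i) (q.map i)) N ≤ 0 := by
    refine (isGLB_infBall _ _ N).1 ⟨matrixTuple n x, fun j => ?_, ?_⟩
    · exact (norm_le_pi_norm _ j).trans ((le_max_right _ _).trans hN)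
    · rw [eval_mvNFormula, ← hx1, ← hx2]
      simp
  rw [← hparams, ← (hA B i hi).2 _ _ (mvNFormula n) N hN1 (mvNParams n p q)] at hB
  -- The infimum over `A` need not be attained, but some tuple has value below `ε`. That value is a
  -- sum of nonnegative terms, so each entry's error is below `ε` too.
  obtain ⟨_, ⟨b, -, rfl⟩, -, hb⟩ :=
    (isGLB_infBall (mvNFormula n) (mvNParams n p q) N).exists_between (hB.trans_lt hε)
  obtain ⟨y, rfl⟩ : ∃ y, matrixTuple n y = b :=
    ⟨fun c d => b (Fintype.equivFin _ (c, d)), by funext j; simp [matrixTuple]⟩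
  rw [eval_mvNFormula] at hb
  have s1 : 0 ≤ ∑ x : n × n, ‖(yᴴ * y - p) x.1 x.2‖ := Finset.sum_nonneg fun _ _ => norm_nonneg _
  have s2 : 0 ≤ ∑ x : n × n, ‖(y * yᴴ - q) x.1 x.2‖ := Finset.sum_nonneg fun _ _ => norm_nonneg _
  refine key y (fun c d => ?_) fun c d => ?_
  · have := Finset.single_le_sum (f := fun x : n × n => ‖(yᴴ * y - p) x.1 x.2‖)
      (fun _ _ => norm_nonneg _) (Finset.mem_univ (c, d))
    dsimp only at this
    linarith
  · have := Finset.single_le_sum (f := fun x : n × n => ‖(y * yᴴ - q) x.1 x.2‖)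
      (fun _ _ => norm_nonneg _) (Finset.mem_univ (c, d))
    dsimp only at this
    linarith

end MvNFormula

end CStarLogic

/-! ### Doubling projections and the vanishing of `K0`. -/

namespace CStarK

open Matrix

variable {n : Type*} [Fintype n]

/-- Padding by zero is needed because the descent from an extension compares matrices of equal size.
-/
lemma mvN_fromBlocks_zero {A : Type u} [CStarAlgebra A] {p : Matrix n n A}
    (hp : IsStarProjection p) : MvN p (fromBlocks p 0 0 (0 : Matrix n n A)) := by
  have h1 : p * p = p := hp.isIdempotentElem
  have h2 : pᴴ = p := hp.isSelfAdjoint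
  refine ⟨fromRows p 0, ?_, ?_⟩
  · simp [conjTranspose_fromRows_eq_fromCols_conjTranspose, fromCols_mul_fromRows, h1, h2]
  · ext (a | a) (b | b) <;>
      simp [conjTranspose_fromRows_eq_fromCols_conjTranspose, h1, h2]

/-- If `𝒪₂` sits in the commutant of the entries of a projection `p`, then `p ∼ p ⊕ p`. -/
lemma mvN_fromBlocks_self_of_commute {B : Type u} [CStarAlgebra B] {p : Matrix n n B}
    (hp : IsStarProjection p) {c : Bool → B}
    (h1 : star (c true) * c true + star (c false) * c false = 1)
    (h2 : ∀ j k, c j * star (c k) = if j = k then 1 else 0)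
    (hc : ∀ j a b, Commute (c j) (p a b)) :
    MvN (fromBlocks p 0 0 (0 : Matrix n n B)) (fromBlocks p 0 0 p) := by
  classical
  have hpp : p * p = p := hp.isIdempotentElem
  have hps : pᴴ = p := hp.isSelfAdjoint
  let C : Bool → Matrix n n B := fun j => Matrix.diagonal fun _ => c j
  have hC (j : Bool) : C j * p = p * C j := by
    ext a b
    simp [C, (hc j a b).eq]
  have hC1 : (C true)ᴴ * C true + (C false)ᴴ * C false = 1 := by
    simp [C, diagonal_conjTranspose, h1, Pi.star_def]
  have hC2 (j k : Bool) : C j * (C k)ᴴ = if j = k then 1 else 0 := by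
    split_ifs with h <;> simp [C, diagonal_conjTranspose, h2, h, Pi.star_def]
  have e (j k : Bool) : C j * p * (p * (C k)ᴴ) = if j = k then p else 0 := by
    calc C j * p * (p * (C k)ᴴ) = C j * (p * p) * (C k)ᴴ := by simp only [Matrix.mul_assoc]
      _ = p * (C j * (C k)ᴴ) := by rw [hpp, hC, Matrix.mul_assoc]
      _ = _ := by rw [hC2]; split_ifs <;> simp
  -- The first block column does the work: the relation summing to `1` gives `p` in the corner, and
  -- the orthogonality relations give `p ⊕ p`.
  refine ⟨fromBlocks (C true * p) 0 (C false * p) 0, ?_, ?_⟩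
  · have : p * (C true)ᴴ * (C true * p) + p * (C false)ᴴ * (C false * p) = p := by
      calc _ = p * ((C true)ᴴ * C true + (C false)ᴴ * C false) * p := by
            simp only [Matrix.mul_add, Matrix.add_mul, Matrix.mul_assoc]
        _ = p := by rw [hC1, Matrix.mul_one, hpp]
    simp [fromBlocks_conjTranspose, fromBlocks_multiply, hps, this]
  · simp [fromBlocks_conjTranspose, fromBlocks_multiply, hps, e]

lemma isStarProjection_map {A B : Type u} [CStarAlgebra A] [CStarAlgebra B] (i : A →⋆ₐ[ℂ] B)
    {p : Matrix n n A} (hp : IsStarProjection p) : IsStarProjection (p.map i) := by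
  have h1 : p * p = p := hp.isIdempotentElem
  have h2 : pᴴ = p := hp.isSelfAdjoint
  refine ⟨?_, ?_⟩
  · rw [IsIdempotentElem, ← Matrix.map_mul, h1]
  · rw [IsSelfAdjoint, star_eq_conjTranspose, ← conjTranspose_map i (map_star i), h2]

/-- Over an existentially closed C⋆-algebra every projection `p` is equivalent to `p ⊕ p`. -/
theorem mvN_fromBlocks_self {A : Type u} [CStarAlgebra A]
    (hA : CStarLogic.IsExistentiallyClosed A) {p : Matrix n n A} (hp : IsStarProjection p) :
    MvN p (fromBlocks p 0 0 p) := by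
  obtain ⟨B, _, i, c, hi, h1, h2, hc⟩ := exists_embedding_commute_cuntz A
  have hpp := isStarProjection_fromBlocks hp hp
  refine (mvN_fromBlocks_zero hp).trans hp hpp (hA.mvN_of_mvN_map hi
    (isStarProjection_fromBlocks hp (IsStarProjection.zero _)) hpp ?_)
  have := mvN_fromBlocks_self_of_commute (isStarProjection_map i hp) h1 h2
    fun j a b => hc j (p a b)
  simpa [fromBlocks_map] using this

lemma V.add_self {A : Type u} [CStarAlgebra A] (hA : CStarLogic.IsExistentiallyClosed A)
    (v : V A) : v + v = v := by
  obtain ⟨p⟩ := v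
  exact V.mk_eq ((p.mvN_sum p).symm.trans (MatProj.isProj _) p.isProj
    (mvN_fromBlocks_self hA p.isProj).symm)

end CStarK

theorem mainTheorem6 {A : Type u} [CStarAlgebra A] (hA : CStarLogic.IsExistentiallyClosed A) :
    ∀ x : CStarK.K0 A, x = 0 := by
  have hof (v : CStarK.V A) : Algebra.GrothendieckAddGroup.of v = 0 := by
    have := congrArg Algebra.GrothendieckAddGroup.of (CStarK.V.add_self hA v)
    rwa [map_add, add_eq_left] at this
  -- By the universal property, homomorphisms out of `K0` are determined on classes of projections,
  -- where both of these vanish.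
  have hid : AddMonoidHom.id (CStarK.K0 A) = 0 := by
    refine Algebra.GrothendieckAddGroup.lift.symm.injective ?_
    ext v
    simpa using hof v
  exact fun x => DFunLike.congr_fun hid x
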